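/- Let $R$ be a commutative Noetherian ring and $X=\operatorname{Spec} R$. Let $\mathcal T$ be either $D^b(\operatorname{coh} X)$, the bounded derived category of coherent sheaves on $X$, or $\operatorname{Perf}(R)$, the full subcategory of the unbounded derived category $D(R\text{-Mod})$ consisting of the complexes quasi-isomorphic to a finite complex of finitely generated projective $R$-modules. Suppose that $\mathcal T=\langle \mathcal T_1,\mathcal T_2\rangle$ is a semi-orthogonal decomposition, that is, $\mathcal T_1,\mathcal T_2\subset\mathcal T$ are full triangulated subcategories, $\operatorname{Hom}(A_2,A_1)=0$ for all $A_1\in\mathcal T_1$ and $A_2\in\mathcal T_2$, and every object $A\in\mathcal T$ appears in an exact triangle $A_2\to A\to A_1\to A_2[1]$ with $A_i\in\mathcal T_i$. Then $\mathcal T=\mathcal T_1\oplus\mathcal T_2$, i.e. the decomposition is orthogonal: also $\operatorname{Hom}(A_1,A_2)=0$ for all $A_1\in\mathcal T_1$ and $A_2\in\mathcal T_2$, and every object of $\mathcal T$ is isomorphic to $A_1\oplus A_2$ for some $A_i\in\mathcal T_i$. Moreover, if $X$ is connected (the empty space being allowed), then $\mathcal T_1=0$ or $\mathcal T_2=0$.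 -/

import Mathlib

universe u w w'

open CategoryTheory CategoryTheory.Limits CategoryTheory.Pretriangulated AlgebraicGeometry Opposite

/-! ### Semi-orthogonal and orthogonal decompositions of triangulated categories -/

section Decompositions

variable {C : Type*} [Category C] [HasZeroObject C] [HasShift C ℤ] [Preadditive C]
  [∀ n : ℤ, (shiftFunctor C n).Additive] [Pretriangulated C]

/-- `C = ⟨T₁, T₂⟩`: the full subcategories `T₁` and `T₂` are triangulated, every morphism from an
object of `T₂` to an object of `T₁` vanishes, and every object `A` sits in a distinguished
triangle `A₂ ⟶ A ⟶ A₁ ⟶ A₂⟦1⟧` with `Aᵢ` in `Tᵢ`. -/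
structure IsSemiorthogonalDecomposition (T₁ T₂ : ObjectProperty C) : Prop where
  isTriangulated₁ : T₁.IsTriangulated
  isTriangulated₂ : T₂.IsTriangulated
  le_rightOrthogonal : T₁ ≤ T₂.rightOrthogonal
  exists_triangle (A : C) : ∃ (A₂ A₁ : C) (f : A₂ ⟶ A) (g : A ⟶ A₁) (h : A₁ ⟶ A₂⟦(1 : ℤ)⟧),
    T₂ A₂ ∧ T₁ A₁ ∧ Triangle.mk f g h ∈ distTriang C

/-- `C = T₁ ⊕ T₂`: the full subcategories `T₁` and `T₂` are triangulated, all morphisms between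
objects of `T₁` and objects of `T₂`, in either direction, vanish, and every object is isomorphic
to a direct sum of an object of `T₁` and an object of `T₂`. -/
structure IsOrthogonalDecomposition (T₁ T₂ : ObjectProperty C) : Prop where
  isTriangulated₁ : T₁.IsTriangulated
  isTriangulated₂ : T₂.IsTriangulated
  le_rightOrthogonal₁ : T₁ ≤ T₂.rightOrthogonal
  le_rightOrthogonal₂ : T₂ ≤ T₁.rightOrthogonal
  exists_iso (A : C) : ∃ A₁ A₂ : C, T₁ A₁ ∧ T₂ A₂ ∧ Nonempty (A ≅ A₁ ⊞ A₂)

/-- The full subcategory given by `T` is zero: all its objects are zero objects. -/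
def IsZeroSubcategory (T : ObjectProperty C) : Prop :=
  ∀ A : C, T A → IsZero A

end Decompositions

/-! ### Coherent sheaves on the spectrum of a Noetherian ring -/

section Coherent

/-- The property of being a coherent sheaf of modules on a locally Noetherian scheme `X`: locally
on `X`, the sheaf is the cokernel of a morphism between finite free sheaves. (The notion is only
used here for spectra of Noetherian rings; on locally Noetherian schemes, coherent sheaves are
the same as sheaves of modules of finite presentation.) -/
abbrev isCoherentSheaf (X : Scheme.{u}) : ObjectProperty X.Modules :=
  SheafOfModules.isFinitePresentation.{u} X.ringCatSheaf

/-- The category `coh X` of coherent sheaves on a locally Noetherian scheme `X`. -/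
abbrev Coh (X : Scheme.{u}) := (isCoherentSheaf X).FullSubcategory

/-! The category `coh (Spec R)` is abelian: it is equivalent to the category of finitely
generated `R`-modules. -/

variable {R : CommRingCat.{u}}

theorem isCoherentSheaf_tilde [IsNoetherianRing R] (M : ModuleCat.{u} R) [Module.Finite R M] : isCoherentSheaf (Spec R) (tilde M) := by
  obtain ⟨s, hs⟩ := (Module.Finite.fg_top : (⊤ : Submodule R M).FG)
  obtain ⟨t, ht⟩ := (IsNoetherian.noetherian (LinearMap.ker
    (Finsupp.linearCombination R (fun x : ((s : Set M) : Type u) => (x : M)))))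
  let P := presentationTilde M (s : Set M) hs (t : Set _) ht
  have h1 : Finite (s : Set M) := by infer_instance
  have h2 : Finite (t : Set ((s : Set M) →₀ R)) := by infer_instance
  have hP : P.IsFinite := by
    refine @SheafOfModules.Presentation.IsFinite.mk _ _ _ _ _ _ _ P ?_ ?_
    · exact @SheafOfModules.GeneratingSections.IsFiniteType.mk _ _ _ _ _ _ _ P.generators h1
    · exact @SheafOfModules.GeneratingSections.IsFiniteType.mk _ _ _ _ _ _ _ P.relations h2
  let q := P.quasicoherentData
  have hq : q.IsFinitePresentation := by
    refine SheafOfModules.QuasicoherentData.IsFinitePresentation.mk (q := q) fun i => ?_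
    refine @SheafOfModules.Presentation.IsFinite.mk _ _ _ _ _ _ _ (q.presentation i) ?_ ?_
    · exact @SheafOfModules.GeneratingSections.IsFiniteType.mk _ _ _ _ _ _ _ (q.presentation i).generators h1
    · exact @SheafOfModules.GeneratingSections.IsFiniteType.mk _ _ _ _ _ _ _ (q.presentation i).relations h2
  exact SheafOfModules.IsFinitePresentation.mk (M := tilde M) ⟨q, hq⟩

theorem finite_globalSections_of_presentation (M : (Spec R).Modules) (P : M.Presentation) [P.IsFinite] :
    Module.Finite R (moduleSpecΓFunctor.obj M) := by
  obtain ⟨N, ⟨e⟩⟩ := isIso_fromTildeΓ_iff.mp (isIso_fromTildeΓ_of_presentation M P)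
  let p : (tilde.functor R).obj (ModuleCat.of R (P.generators.I →₀ R)) ⟶
      (tilde.functor R).obj N :=
    (tildeFinsupp P.generators.I).hom ≫ P.generators.π ≫ e.inv
  have hp : Epi p := by
    have : Epi P.generators.π := P.generators.epi
    dsimp only [p]
    have h1 : IsIso (tildeFinsupp (R := R) P.generators.I).hom := Iso.isIso_hom (tildeFinsupp (R := R) P.generators.I)
    have h2 : Epi (tildeFinsupp (R := R) P.generators.I).hom := @IsIso.epi_of_iso _ _ _ _ _ h1
    exact epi_comp' (f := (tildeFinsupp (R := R) P.generators.I).hom) h2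
      (epi_comp' this (IsIso.epi_of_iso _))
  let g := (tilde.functor R).preimage p
  have hg : Epi g := by
    apply (tilde.functor R).epi_of_epi_map
    rw [(tilde.functor R).map_preimage]
    exact hp
  rw [ModuleCat.epi_iff_surjective] at hg
  have : Finite P.generators.I := (SheafOfModules.Presentation.IsFinite.isFiniteType_generators (p := P)).finite
  have : Module.Finite R N := Module.Finite.of_surjective g.hom hg
  exact Module.Finite.equiv (M := N)
    ((tilde.toTildeΓNatIso (R := R)).app N ≪≫ moduleSpecΓFunctor.mapIso e).toLinearEquiv

theorem exists_finite_presentation_restrict (M : (Spec R).Modules) (hM : isCoherentSheaf (Spec R) M) (x : Spec R) :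
    ∃ (a : R) (_ : x ∈ PrimeSpectrum.basicOpen a)
      (P : (M.restrict (Spec.map (CommRingCat.ofHom (algebraMap R (Localization.Away a))))).Presentation),
      P.IsFinite := by
  obtain ⟨⟨I, W, cov, pres⟩, hq⟩ := hM.exists_quasicoherentData
  have hx : x ∈ iSup W := by
    rw [Opens.coversTop_iff] at cov
    rw [cov]; trivial
  obtain ⟨i, hi⟩ := TopologicalSpace.Opens.mem_iSup.mp hx
  obtain ⟨_, ⟨_, ⟨a, rfl⟩, rfl⟩, hxa, ha⟩ :=
    PrimeSpectrum.isBasis_basic_opens.exists_subset_of_mem_open hi (W i).2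
  refine ⟨a, hxa, ?_⟩
  let V : (Spec R).Opens := W i
  let j : Spec (CommRingCat.of (Localization.Away a)) ⟶ Spec R :=
    Spec.map (CommRingCat.ofHom (algebraMap R (Localization.Away a)))
  have hj : IsOpenImmersion j := inferInstanceAs
    (IsOpenImmersion (Spec.map (CommRingCat.ofHom (algebraMap R (Localization.Away a)))))
  have hr : Set.range j ⊆ Set.range V.ι := by
    rw [Scheme.Opens.range_ι]
    rintro _ ⟨y, rfl⟩
    refine ha ?_
    have := PrimeSpectrum.localization_away_comap_range (Localization.Away a) a
    rw [← this]
    exact ⟨y, rfl⟩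
  let t := IsOpenImmersion.lift V.ι j hr
  have hfac : t ≫ V.ι = j := IsOpenImmersion.lift_fac _ _ _
  have : IsOpenImmersion (t ≫ V.ι) := by rw [hfac]; exact hj
  have : IsOpenImmersion t := IsOpenImmersion.of_comp t V.ι
  have : PreservesColimitsOfSize.{u, u} (Scheme.Modules.restrictFunctor t) := inferInstance
  let F : SheafOfModules.{u} ((Spec R).ringCatSheaf.over V) ⥤
      SheafOfModules.{u} (Spec (CommRingCat.of (Localization.Away a))).ringCatSheaf :=
    (Scheme.Modules.overEquiv V).functor ⋙ Scheme.Modules.restrictFunctor t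
  let iso : SheafOfModules.overFunctor (Spec R).ringCatSheaf _ ⋙ F ≅
      Scheme.Modules.restrictFunctor (Spec.map (CommRingCat.ofHom (algebraMap R (Localization.Away a)))) :=
    (Functor.associator _ _ _).symm ≪≫
      Functor.isoWhiskerRight (Scheme.Modules.overFunctorEquiv _) _ ≪≫
      (Scheme.Modules.restrictFunctorComp _ _).symm ≪≫
      (Scheme.Modules.restrictFunctorCongr hfac)
  have hF : PreservesColimitsOfSize.{u, u} F :=
    comp_preservesColimits (Scheme.Modules.overEquiv V).functor (Scheme.Modules.restrictFunctor t)
  have hf := hq.isFinite_presentation i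
  let Q := (pres i).map F (Scheme.Modules.restrictUnitIso _).symm
  have hQ : Q.IsFinite :=
    SheafOfModules.Presentation.IsFinite.mk
      (SheafOfModules.GeneratingSections.IsFiniteType.mk
        (show Finite (pres i).generators.I from hf.isFiniteType_generators.finite))
      (SheafOfModules.GeneratingSections.IsFiniteType.mk
        (show Finite (pres i).relations.I from hf.isFiniteType_relations.finite))
  let q : F.obj (SheafOfModules.over M V) ⟶ M.restrict j := iso.hom.app M
  have hiso : IsIso q := Iso.isIso_hom (iso.app M)
  let Q' : (M.restrict j).Presentation := SheafOfModules.Presentation.ofIsIso.{u, u, u} q Q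
  exact ⟨Q', SheafOfModules.Presentation.IsFinite.mk (p := Q')
    (SheafOfModules.GeneratingSections.IsFiniteType.mk
      (show Finite Q'.generators.I from hQ.isFiniteType_generators.finite))
    (SheafOfModules.GeneratingSections.IsFiniteType.mk
      (show Finite Q'.relations.I from hQ.isFiniteType_relations.finite))⟩

theorem exists_localized_globalSections (M : (Spec R).Modules) (hloc : IsLocalizing (modulesSpecToSheaf.obj M))
    {S : CommRingCat.{u}} [Algebra R S] (f : R ⟶ S) (hf : ∀ r, f r = algebraMap R S r)
    [IsOpenImmersion (Spec.map f)] (g : R)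
    (D : (Spec R).Opens) (hDg : D = PrimeSpectrum.basicOpen g) (hD : (Spec.map f) ''ᵁ ⊤ = D)
    (hfin : Module.Finite S (moduleSpecΓFunctor.obj (M.restrict (Spec.map f)))) :
    ∃ (N : Type u) (_ : AddCommGroup N) (_ : Module R N) (_ : Module S N) (_ : IsScalarTower R S N)
      (ψ : moduleSpecΓFunctor.obj M →ₗ[R] N), IsLocalizedModule.Away g ψ ∧ Module.Finite S N := by
  let _ : Module R Γ(M.restrict (Spec.map f), ⊤) := Module.compHom _ f.hom
  let i : Γ(M.restrict (Spec.map f), ⊤) ≅ Γ(M, D) :=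
    M.restrictAppIso (Spec.map f) ⊤ ≪≫ M.presheaf.mapIso (eqToIso hD.symm).op
  let e : Γ(M.restrict (Spec.map f), ⊤) ≃ₗ[R] Γ(M, D) :=
    { i.addCommGroupIsoToAddEquiv with
      map_smul' := by
        intro r x
        change M.presheaf.map _ ((M.restrictAppIso (Spec.map f) ⊤).hom (f r • x)) =
          r • M.presheaf.map _ ((M.restrictAppIso (Spec.map f) ⊤).hom x)
        rw [Scheme.Modules.restrictAppIso_smul_Spec, Scheme.Modules.map_smul_Spec] }
  let e' : (modulesSpecToSheaf.obj M).obj.obj (op D) ≃ₗ[R]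
    Γ(M.restrict (Spec.map f), ⊤) := e.symm
  let φ : (modulesSpecToSheaf.obj M).obj.obj (op ⊤) →ₗ[R]
    (modulesSpecToSheaf.obj M).obj.obj (op D) := ((modulesSpecToSheaf.obj M).obj.map D.leTop.op).hom
  have hφ : IsLocalizedModule (.powers g) φ := by
    subst hDg
    exact hloc g
  exact ⟨Γ(M.restrict (Spec.map f), ⊤), inferInstance, inferInstance, inferInstance,
    .of_algebraMap_smul fun r x => by rw [← hf]; rfl,
    e'.toLinearMap ∘ₗ φ, IsLocalizedModule.of_linearEquiv (hf := hφ) (.powers g) φ e', hfin⟩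

theorem finite_globalSections (M : (Spec R).Modules) (hM : isCoherentSheaf (Spec R) M) :
    Module.Finite R (moduleSpecΓFunctor.obj M) := by
  choose a ha P hP using exists_finite_presentation_restrict M hM
  have hloc : IsLocalizing (modulesSpecToSheaf.obj M) := by
    obtain ⟨q, -⟩ := hM.exists_quasicoherentData
    have : M.IsQuasicoherent := q.isQuasicoherent
    exact (isIso_fromTildeΓ_iff_isLocalizing M).mp
      ((isQuasicoherent_iff_isIso_fromTildeΓ M).mp this)
  have hspan : Ideal.span (Set.range a) = ⊤ := by
    rw [← PrimeSpectrum.iSup_basicOpen_eq_top_iff, eq_top_iff]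
    intro x _
    exact TopologicalSpace.Opens.mem_iSup.mpr ⟨x, ha x⟩
  have key (g : Set.range a) : ∃ (N : Type u) (_ : AddCommGroup N) (_ : Module R N)
      (_ : Module (Localization.Away g.1) N) (_ : IsScalarTower R (Localization.Away g.1) N)
      (ψ : moduleSpecΓFunctor.obj M →ₗ[R] N), IsLocalizedModule.Away g.1 ψ ∧
        Module.Finite (Localization.Away g.1) N := by
    obtain ⟨_, x, rfl⟩ := g
    let f := CommRingCat.ofHom (algebraMap R (Localization.Away (a x)))
    have hD : (Spec.map f) ''ᵁ ⊤ = PrimeSpectrum.basicOpen (a x) := by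
      simp [f]
      rfl
    exact exists_localized_globalSections (S := CommRingCat.of (Localization.Away (a x))) M hloc f (fun _ => rfl)
      (a x) _ rfl hD (finite_globalSections_of_presentation _ (P x))
  choose N h1 h2 h3 h4 ψ h5 h6 using key
  exact Module.Finite.of_localizationSpan' (Set.range a) hspan
    (Rₚ := fun g => Localization.Away g.1) (Mₚ := N) ψ h6
instance (X : Scheme.{u}) : (isCoherentSheaf X).IsClosedUnderIsomorphisms :=
  inferInstanceAs (SheafOfModules.isFinitePresentation.{u} X.ringCatSheaf).IsClosedUnderIsomorphisms

theorem isCoherentSheaf_iff_exists_tilde [IsNoetherianRing R] (M : (Spec R).Modules) :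
   isCoherentSheaf (Spec R) M ↔ ∃ (N : ModuleCat.{u} R) (_ : Module.Finite R N), Nonempty (tilde N ≅ M) := by
  constructor
  · intro h
    refine ⟨_, finite_globalSections M h, ?_⟩
    obtain ⟨q, -⟩ := h.exists_quasicoherentData
    have : M.IsQuasicoherent := q.isQuasicoherent
    have := (isQuasicoherent_iff_isIso_fromTildeΓ M).mp this
    exact ⟨@asIso _ _ _ _ M.fromTildeΓ this⟩
  · rintro ⟨N, _, ⟨e⟩⟩
    exact (isCoherentSheaf (Spec R)).prop_of_iso e (isCoherentSheaf_tilde N)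

/-- The functor `M ↦ M^~` from finitely generated modules to coherent sheaves. -/
noncomputable def cohTilde (R : CommRingCat.{u}) [IsNoetherianRing R] :
    FGModuleCat.{u} R ⥤ Coh (Spec R) :=
  (isCoherentSheaf (Spec R)).lift ((ModuleCat.isFG R).ι ⋙ tilde.functor R) fun N =>
    have : Module.Finite R N.obj := N.2
    isCoherentSheaf_tilde N.obj

/-- The functor `M ↦ M^~` is fully faithful. -/
noncomputable def cohTildeFullyFaithful (R : CommRingCat.{u}) [IsNoetherianRing R] : (cohTilde R).FullyFaithful where
  preimage f := ObjectProperty.homMk (tilde.fullyFaithfulFunctor.preimage f.hom)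
  map_preimage f := ObjectProperty.hom_ext _ (tilde.fullyFaithfulFunctor.map_preimage f.hom)
  preimage_map f := ObjectProperty.hom_ext _ (tilde.fullyFaithfulFunctor.preimage_map f.hom)
instance [IsNoetherianRing R] : (cohTilde R).Full := (cohTildeFullyFaithful R).full
instance [IsNoetherianRing R] : (cohTilde R).Faithful := (cohTildeFullyFaithful R).faithful
instance [IsNoetherianRing R] : (cohTilde R).EssSurj where
  mem_essImage M := by
    obtain ⟨N, hN, ⟨e⟩⟩ := (isCoherentSheaf_iff_exists_tilde M.obj).1 M.2
    exact ⟨⟨N, hN⟩, ⟨ObjectProperty.isoMk _ e⟩⟩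
instance [IsNoetherianRing R] : (cohTilde R).IsEquivalence where

noncomputable instance [IsNoetherianRing R] : HasFiniteProducts (Coh (Spec R)) where
  out _ := Adjunction.hasLimitsOfShape_of_equivalence (cohTilde R).inv

noncomputable instance [IsNoetherianRing R] : Abelian (Coh (Spec R)) :=
  abelianOfEquivalence (cohTilde R).inv

/-- `D^b(coh X)` for `X = Spec R`, `R` Noetherian: the full subcategory of the derived category of
the abelian category `coh X` consisting of the (cohomologically) bounded complexes. -/
abbrev DbCohSpec (R : Type u) [CommRing R] [IsNoetherianRing R]
    [HasDerivedCategory.{w} (Coh (Spec (CommRingCat.of R)))] :=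
  DerivedCategory.Bounded (Coh (Spec (CommRingCat.of R)))

end Coherent

/-! ### Perfect complexes -/

section Perfect

variable (R : Type u) [CommRing R]

/-- A finite complex consisting of finitely generated projective `R`-modules. -/
def IsStrictlyPerfect (K : CochainComplex (ModuleCat.{u} R) ℤ) : Prop :=
  (∃ a b : ℤ, ∀ n : ℤ, n < a ∨ b < n → IsZero (K.X n)) ∧
    ∀ n : ℤ, Module.Finite R (K.X n) ∧ Module.Projective R (K.X n)

/-- The property of objects of `D(R-Mod)` that are isomorphic, in the derived category, to a finite
complex of finitely generated projective modules. -/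
def isPerfect [HasDerivedCategory.{w} (ModuleCat.{u} R)] :
    ObjectProperty (DerivedCategory (ModuleCat.{u} R)) :=
  fun X => ∃ K : CochainComplex (ModuleCat.{u} R) ℤ, IsStrictlyPerfect R K ∧
    Nonempty (X ≅ DerivedCategory.Q.obj K)

/-- `Perf(R)`, as a full subcategory of `D(R-Mod)`. -/
abbrev Perf [HasDerivedCategory.{w} (ModuleCat.{u} R)] := (isPerfect R).FullSubcategory

/-! `Perf(R)` is a triangulated subcategory of `D(R-Mod)`. -/

variable {R}

theorem IsStrictlyPerfect.isKProjective {K : CochainComplex (ModuleCat.{u} R) ℤ}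
    (hK : IsStrictlyPerfect R K) : K.IsKProjective := by
  obtain ⟨⟨a, b, hab⟩, h⟩ := hK
  have : K.IsStrictlyLE b := (K.isStrictlyLE_iff b).2 fun i hi => hab i (Or.inr hi)
  have (n : ℤ) : Projective (K.X n) := by
    have := (h n).2
    exact (IsProjective.iff_projective (K.X n)).1 this
  exact CochainComplex.isKProjective_of_projective K b

theorem IsStrictlyPerfect.shift {K : CochainComplex (ModuleCat.{u} R) ℤ}
    (hK : IsStrictlyPerfect R K) (m : ℤ) : IsStrictlyPerfect R (K⟦m⟧) := by
  obtain ⟨⟨a, b, hab⟩, h⟩ := hK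
  refine ⟨⟨a - m, b - m, fun n hn => hab (n + m) (by omega)⟩, fun n => h (n + m)⟩

theorem IsStrictlyPerfect.mappingCone {K L : CochainComplex (ModuleCat.{u} R) ℤ}
    (hK : IsStrictlyPerfect R K) (hL : IsStrictlyPerfect R L) (f : K ⟶ L) :
    IsStrictlyPerfect R (CochainComplex.mappingCone f) := by
  obtain ⟨⟨a, b, hab⟩, h⟩ := hK
  obtain ⟨⟨a', b', hab'⟩, h'⟩ := hL
  have e (n : ℤ) : (CochainComplex.mappingCone f).X n ≅ K.X (n + 1) ⊞ L.X n :=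
    HomologicalComplex.homotopyCofiber.XIsoBiprod f n (n + 1) rfl
  refine ⟨⟨min (a - 1) a', max b b', fun n hn => ?_⟩, fun n => ?_⟩
  · refine IsZero.of_iso ?_ (e n)
    rw [biprod_isZero_iff]
    exact ⟨hab _ (by omega), hab' _ (by omega)⟩
  · have := h (n + 1)
    have := h' n
    let e' := ((e n) ≪≫ ModuleCat.biprodIsoProd _ _).toLinearEquiv.symm
    obtain ⟨_, _⟩ := h (n + 1)
    obtain ⟨_, _⟩ := h' n
    have h1 : Module.Finite R (K.X (n + 1) × L.X n) := inferInstance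
    have h2 : Module.Projective R (K.X (n + 1) × L.X n) := inferInstance
    exact ⟨Module.Finite.equiv e', Module.Projective.of_equiv e'⟩

theorem isStrictlyPerfect_of_isZero {K : CochainComplex (ModuleCat.{u} R) ℤ} (hK : IsZero K) :
    IsStrictlyPerfect R K := by
  have h (n : ℤ) : IsZero (K.X n) := (HomologicalComplex.eval _ _ n).map_isZero hK
  refine ⟨⟨0, 0, fun n _ => h n⟩, fun n => ?_⟩
  have := ModuleCat.subsingleton_of_isZero (h n)
  exact ⟨inferInstance, inferInstance⟩

variable [HasDerivedCategory.{w} (ModuleCat.{u} R)]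

instance : (isPerfect R).IsClosedUnderIsomorphisms where
  of_iso e := fun ⟨K, hK, ⟨e'⟩⟩ => ⟨K, hK, ⟨e.symm ≪≫ e'⟩⟩

instance : (isPerfect R).ContainsZero where
  exists_zero := ⟨_, DerivedCategory.Q.map_isZero (isZero_zero _), _,
    isStrictlyPerfect_of_isZero (isZero_zero _),
    ⟨Iso.refl _⟩⟩

instance : (isPerfect R).IsStableUnderShift ℤ where
  isStableUnderShiftBy m := ⟨by
    rintro X ⟨K, hK, ⟨e⟩⟩
    exact ⟨K⟦m⟧, hK.shift m, ⟨(shiftFunctor _ m).mapIso e ≪≫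
      (DerivedCategory.Q.commShiftIso m).symm.app K⟩⟩⟩

theorem exists_Q_map_eq_of_isKProjective {K L : CochainComplex (ModuleCat.{u} R) ℤ} [K.IsKProjective]
    (g : DerivedCategory.Q.obj K ⟶ DerivedCategory.Q.obj L) :
    ∃ f : K ⟶ L, DerivedCategory.Q.map f = g := by
  let e := DerivedCategory.quotientCompQhIso (ModuleCat.{u} R)
  obtain ⟨f₁, hf₁⟩ := (CochainComplex.IsKProjective.Qh_map_bijective K
    ((HomotopyCategory.quotient _ _).obj L)).2 (e.hom.app K ≫ g ≫ e.inv.app L)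
  obtain ⟨f, rfl⟩ := (HomotopyCategory.quotient _ _).map_surjective f₁
  refine ⟨f, ?_⟩
  have := DerivedCategory.quotientCompQhIso_hom_naturality f
  rw [hf₁] at this
  rw [← cancel_epi (e.hom.app K), ← this]
  simp [e]

instance : (isPerfect R).IsTriangulatedClosed₃ := .mk' (by
  rintro T hT ⟨K, hK, ⟨eK⟩⟩ ⟨L, hL, ⟨eL⟩⟩
  have := hK.isKProjective
  obtain ⟨f, hf⟩ := exists_Q_map_eq_of_isKProjective (eK.inv ≫ T.mor₁ ≫ eL.hom)
  have h : T.mor₁ ≫ eL.hom = eK.hom ≫ DerivedCategory.Q.map f := by simp [hf]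
  refine ⟨_, hK.mappingCone hL f, ⟨Triangle.π₃.mapIso (isoTriangleOfIso₁₂ _ _ hT
    (DerivedCategory.mappingCone_triangle_distinguished f) eK eL h)⟩⟩)

instance : (isPerfect R).IsTriangulated where
  toIsTriangulatedClosed₂ := .of_isTriangulatedClosed₃

end Perfect

/-!
Both categories carry an action of `R` and cohomology functors `Hⁿ` with values in finitely
generated `R`-modules, only finitely many of which are nonzero on a given object. The proof only
uses the properties of these functors collected in `IsBoundedFiniteCohomology`; they are verified
in `DerivedCategory.isBoundedFiniteCohomology` for categories of bounded complexes in an abelian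
category `A` with a fully faithful exact functor to `R`-modules, namely the identity for `Perf(R)`
and the global sections functor for `coh (Spec R)`.

The main point (`IsBoundedFiniteCohomology.sup_cohomologyAnnihilator_eq_top`) is that objects `A₁`
of `T₁` and `A₂` of `T₂` have disjoint cohomological supports. Suppose that a maximal ideal `m`
belongs to both supports. Taking successive cones of the multiplications by generators of `m`
replaces each `Aᵢ` by an object `Bᵢ` of `Tᵢ` on which `m` acts nilpotently; by Nakayama's lemma
(`annihilator_le_of_exact_smul`), `m` remains in the support, so that `Bᵢ` is nonzero. The top
cohomology module of `B₂` then surjects onto `R/m`, which embeds into the bottom cohomology module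
of `B₁`. The composition is induced by a nonzero morphism from `B₂` to a shift of `B₁`,
contradicting semi-orthogonality.

Disjointness of supports is a symmetric condition. It provides `a + b = 1` with `a` acting by zero
on the cohomology of `A₁` and `b` on that of `A₂`; hence `a` acts nilpotently on `A₁` and `b` on
`A₂`, as shown by dévissage along truncations (`DerivedCategory.pow_smul_id_eq_zero`). All
morphisms between `A₁` and `A₂` are killed by powers of both, so they vanish, and the triangles of
the decomposition split.

If `Spec R` is connected, decompose the object `R`, or the structure sheaf, as `A₂ ⟶ R ⟶ A₁`. The
above elements satisfy `ab = 0`, so `a` is an idempotent, hence `0` or `1`. Therefore one of the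
`Aᵢ` has zero cohomology annihilator, and every object of the other subcategory, having support
disjoint from the whole spectrum, is zero.
-/

/-! ### Modules over commutative rings -/

section Algebra

variable {R : Type*} [CommRing R]

/-- Nakayama's lemma, in the form needed for cones of multiplication maps: the cokernel of
multiplication by `x ∈ m` on `M` has `m` in its support as soon as `M` has. -/
theorem annihilator_le_of_exact_smul {M N : Type*} [AddCommGroup M] [Module R M]
    [AddCommGroup N] [Module R N] [Module.Finite R M] {m : Ideal R} [hm : m.IsMaximal] {x : R}
    (hx : x ∈ m) (hM : Module.annihilator R M ≤ m) (g : M →ₗ[R] N)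
    (hg : ∀ y, g y = 0 → ∃ z, x • z = y) : Module.annihilator R N ≤ m := by
  intro s hs
  by_contra hsm
  -- An `s ∉ m` killing `N` would give `s • M ⊆ x • M`; as `s` is invertible modulo `m`, this would
  -- imply `M = m • M`.
  obtain ⟨t, i, hi, hti⟩ := hm.exists_inv hsm
  have hle : (⊤ : Submodule R M) ≤ m • ⊤ := by
    intro y _
    obtain ⟨z, hz⟩ := hg (s • y) (by rw [map_smul]; exact Module.mem_annihilator.1 hs _)
    have : y = x • (t • z) + i • y := by
      rw [smul_comm, hz, ← mul_smul, ← add_smul, hti, one_smul]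
    rw [this]
    exact add_mem (Submodule.smul_mem_smul hx trivial) (Submodule.smul_mem_smul hi trivial)
  obtain ⟨r, hr, h⟩ := Submodule.exists_sub_one_mem_and_smul_eq_zero_of_fg_of_le_smul m ⊤
    Module.Finite.fg_top hle
  have hrm : r ∈ m := hM (Module.mem_annihilator.2 fun y => h y trivial)
  exact hm.ne_top ((Ideal.eq_top_iff_one m).2 (by simpa using sub_mem hrm hr))

/-- Nonzero modules supported only at the maximal ideal `m` admit a nonzero map `M ⟶ R/m ⟶ N`: a
simple quotient of `M`, followed by the embedding given by an associated prime of `N`. -/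
theorem exists_linearMap_ne_zero {M N : Type*} [AddCommGroup M] [Module R M]
    [AddCommGroup N] [Module R N] [IsNoetherianRing R] [Module.Finite R M] [Nontrivial M]
    [Nontrivial N] {m : Ideal R} [hm : m.IsMaximal]
    (hM : m ≤ (Module.annihilator R M).radical) (hN : m ≤ (Module.annihilator R N).radical) :
    ∃ f : M →ₗ[R] N, f ≠ 0 := by
  -- Both an associated prime of `N` and the annihilator of a simple quotient of `M` equal `m`.
  have key {I : Ideal R} (p : Ideal R) [hp : p.IsPrime] (h : m ≤ I.radical) (hI : I ≤ p) :
      p = m := (hm.eq_of_le hp.ne_top (h.trans (hp.radical_le_iff.2 hI))).symm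
  obtain ⟨p, hp⟩ := associatedPrimes.nonempty R N
  obtain ⟨_, j, hj⟩ := (isAssociatedPrime_iff_exists_injective_linearMap p N).1 hp
  have hpm := key p hN (by
    simpa only [Submodule.annihilator_top] using hp.annihilator_le)
  obtain ⟨L, hL, -⟩ := (eq_top_or_exists_le_coatom (⊥ : Submodule R M)).resolve_left bot_ne_top
  have : IsSimpleModule R (M ⧸ L) := isSimpleModule_iff_isCoatom.2 hL
  obtain ⟨q, hq, ⟨e⟩⟩ := isSimpleModule_iff_quot_maximal.1 this
  have hqm := key q hM (fun r hr => by
    have : r • e.symm (1 : R ⧸ q) = 0 := by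
      obtain ⟨y, hy⟩ := L.mkQ_surjective (e.symm 1)
      rw [← hy, ← map_smul, Module.mem_annihilator.1 hr, map_zero]
    rw [← map_smul, LinearEquiv.map_eq_zero_iff, Algebra.smul_def, mul_one] at this
    exact Ideal.Quotient.eq_zero_iff_mem.1 this)
  subst hpm
  subst hqm
  refine ⟨j ∘ₗ e.toLinearMap ∘ₗ L.mkQ, fun h => hL.1 ?_⟩
  rw [eq_top_iff]
  intro y _
  have := LinearMap.congr_fun h y
  simpa [map_eq_zero_iff j hj] using this

theorem IsIdempotentElem.eq_zero_or_eq_one_of_preconnectedSpace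
    [PreconnectedSpace (PrimeSpectrum R)] {e : R} (he : IsIdempotentElem e) : e = 0 ∨ e = 1 := by
  have h := isClopen_iff.1 (PrimeSpectrum.isClopen_iff.2 ⟨e, he, rfl⟩)
  let E := PrimeSpectrum.isIdempotentElemEquivClopens (R := R)
  have hinj (e' : R) (he' : IsIdempotentElem e')
      (h : (PrimeSpectrum.basicOpen e : Set (PrimeSpectrum R)) = PrimeSpectrum.basicOpen e') :
      e = e' := by
    have : (⟨e, he⟩ : {e : R // IsIdempotentElem e}) = ⟨e', he'⟩ :=
      E.injective (TopologicalSpace.Clopens.ext h)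
    exact congrArg Subtype.val this
  exact h.imp (fun h => hinj 0 .zero (by simp [h])) (fun h => hinj 1 .one (by simp [h]))

end Algebra

/-! ### Cohomology theories with values in finitely generated modules -/

section Abstract

section

variable {R : Type u} [CommRing R] {C : Type*} [Category C]

/-- The ideal of all ring elements acting by zero on the cohomology of `X`. Its zero locus is the
cohomological support of `X`. -/
noncomputable def cohomologyAnnihilator (H : ℤ → C ⥤ ModuleCat.{u} R) (X : C) : Ideal R :=
  ⨅ n, Module.annihilator R ((H n).obj X)

theorem mem_cohomologyAnnihilator {H : ℤ → C ⥤ ModuleCat.{u} R} {X : C} {r : R} :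
    r ∈ cohomologyAnnihilator H X ↔ ∀ n (x : (H n).obj X), r • x = 0 := by
  simp only [cohomologyAnnihilator, Submodule.mem_iInf, Module.mem_annihilator]

end

variable {R : Type u} [CommRing R] {C : Type*} [Category C] [HasZeroObject C] [HasShift C ℤ]
  [Preadditive C] [∀ n : ℤ, (shiftFunctor C n).Additive] [Pretriangulated C] [Linear R C]

/-- If the ring element `r` kills the first map and `s` the second map of a distinguished triangle,
then `s * r` is zero on the middle object. -/
theorem mul_smul_id_obj₂_eq_zero {T : Triangle C} (hT : T ∈ distTriang C) {r s : R}
    (hr : r • T.mor₁ = 0) (hs : s • T.mor₂ = 0) : (s * r) • 𝟙 T.obj₂ = 0 := by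
  obtain ⟨g, hg⟩ := T.coyoneda_exact₂ hT (s • 𝟙 T.obj₂) (by simpa using hs)
  rw [mul_comm, mul_smul, hg, ← Linear.comp_smul, hr, comp_zero]

/-- A family `H` of cohomology functors `Hⁿ : C ⥤ R-Mod` on an `R`-linear triangulated category
which behaves like the cohomology of bounded complexes with finitely generated cohomology over a
Noetherian ring `R`. -/
structure IsBoundedFiniteCohomology (H : ℤ → C ⥤ ModuleCat.{u} R) : Prop where
  linear (n : ℤ) : (H n).Linear R
  exact (n : ℤ) (T : Triangle C) (hT : T ∈ distTriang C) :
    Function.Exact ((H n).map T.mor₁).hom ((H n).map T.mor₂).hom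
  finite (n : ℤ) (X : C) : Module.Finite R ((H n).obj X)
  bounded (X : C) : ∃ a b : ℤ, ∀ n, n < a ∨ b < n → Subsingleton ((H n).obj X)
  /-- A ring element acting by zero on the cohomology of `X` acts nilpotently on `X`. -/
  nilpotent (X : C) (r : R) (hr : ∀ n, r ∈ Module.annihilator R ((H n).obj X)) :
    ∃ N : ℕ, r ^ N • 𝟙 X = 0
  /-- A nonzero map from the top cohomology of `X` to the bottom cohomology of `Y` yields a nonzero
  morphism to a shift of `Y`: in a derived category, the composition
  `X ⟶ Hᵗ(X)[-t] ⟶ Hᵇ(Y)[-t] ⟶ Y[b - t]`. -/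
  exists_hom_ne_zero (X Y : C) (t b : ℤ) (hX : ∀ n, t < n → Subsingleton ((H n).obj X))
    (hY : ∀ n, n < b → Subsingleton ((H n).obj Y)) (f : (H t).obj X ⟶ (H b).obj Y) (hf : f ≠ 0) :
    ∃ (k : ℤ) (g : X ⟶ Y⟦k⟧), g ≠ 0

namespace IsBoundedFiniteCohomology

variable {H : ℤ → C ⥤ ModuleCat.{u} R}

theorem pow_mem_annihilator (h : IsBoundedFiniteCohomology H) {X : C} {r : R} {N : ℕ}
    (hr : r ^ N • 𝟙 X = 0) (n : ℤ) : r ^ N ∈ Module.annihilator R ((H n).obj X) := by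
  have := h.linear n
  have h0 : (H n).map (0 : X ⟶ X) = 0 := by simpa using (H n).map_smul (0 : R) (0 : X ⟶ X)
  have h1 := (H n).map_smul (r ^ N) (𝟙 X)
  rw [hr, h0, CategoryTheory.Functor.map_id] at h1
  rw [Module.mem_annihilator]
  intro x
  exact (congrArg (fun f => f.hom x) h1).symm

/-- The cohomological support is the union of the supports of the finitely many nonzero
cohomology modules. -/
theorem exists_annihilator_le (h : IsBoundedFiniteCohomology H) {X : C} {p : Ideal R}
    [hp : p.IsPrime] (hX : cohomologyAnnihilator H X ≤ p) :
    ∃ n, Module.annihilator R ((H n).obj X) ≤ p := by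
  obtain ⟨a, b, hab⟩ := h.bounded X
  have hle : (Finset.Icc a b).inf (fun n => Module.annihilator R ((H n).obj X)) ≤ p := by
    refine le_trans (le_iInf fun n => ?_) hX
    by_cases hn : n ∈ Finset.Icc a b
    · exact Finset.inf_le hn
    · rw [Finset.mem_Icc] at hn
      have := hab n (by omega)
      rw [Module.annihilator_eq_top_iff.2 this]
      exact le_top
  obtain ⟨n, -, hn⟩ := (Ideal.IsPrime.inf_le' hp).1 hle
  exact ⟨n, hn⟩

theorem isZero_of_cohomologyAnnihilator_eq_top (h : IsBoundedFiniteCohomology H) {X : C}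
    (hX : cohomologyAnnihilator H X = ⊤) : IsZero X := by
  obtain ⟨N, hN⟩ := h.nilpotent X 1 fun n => by
    have : (1 : R) ∈ cohomologyAnnihilator H X := hX ▸ trivial
    exact (Submodule.mem_iInf _).1 this n
  rw [IsZero.iff_id_eq_zero]
  simpa using hN

/-- Objects with disjoint cohomological supports are orthogonal. -/
theorem hom_eq_zero_of_sup_eq_top (h : IsBoundedFiniteCohomology H) {X Y : C}
    (hXY : cohomologyAnnihilator H X ⊔ cohomologyAnnihilator H Y = ⊤) (f : X ⟶ Y) : f = 0 := by
  obtain ⟨a, ha, b, hb, hab⟩ := Submodule.mem_sup.1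
    (show (1 : R) ∈ cohomologyAnnihilator H X ⊔ cohomologyAnnihilator H Y from hXY ▸ trivial)
  obtain ⟨N, hN⟩ := h.nilpotent X a ((Submodule.mem_iInf _).1 ha)
  obtain ⟨M, hM⟩ := h.nilpotent Y b ((Submodule.mem_iInf _).1 hb)
  have hco : IsCoprime a b := ⟨1, 1, by simpa using hab⟩
  obtain ⟨c, d, hcd⟩ := hco.pow (m := N) (n := M)
  have h1 : a ^ N • f = 0 := by
    rw [← Category.id_comp f, ← Linear.smul_comp, hN, zero_comp]
  have h2 : b ^ M • f = 0 := by
    rw [← Category.comp_id f, ← Linear.comp_smul, hM, comp_zero]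
  rw [← one_smul R f, ← hcd, add_smul, mul_smul, mul_smul, h1, h2]
  simp

theorem le_radical_annihilator (h : IsBoundedFiniteCohomology H) {X : C} {s : Finset R}
    (hs : ∀ x ∈ s, ∃ N : ℕ, x ^ N • 𝟙 X = 0) (n : ℤ) :
    Ideal.span (s : Set R) ≤ (Module.annihilator R ((H n).obj X)).radical := by
  rw [Ideal.span_le]
  intro x hx
  obtain ⟨N, hN⟩ := hs x hx
  exact ⟨N, h.pow_mem_annihilator hN n⟩

/-- An object with nonzero cohomology has a top cohomology module. -/
theorem exists_top (h : IsBoundedFiniteCohomology H) {X : C} {i : ℤ}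
    (hi : Nontrivial ((H i).obj X)) :
    ∃ t, Nontrivial ((H t).obj X) ∧ ∀ n, t < n → Subsingleton ((H n).obj X) := by
  obtain ⟨a, b, hab⟩ := h.bounded X
  obtain ⟨t, ht, hmax⟩ := Int.exists_greatest_of_bdd (P := fun n => Nontrivial ((H n).obj X))
    ⟨b, fun n hn => by
      by_contra hbn
      exact not_subsingleton_iff_nontrivial.2 hn (hab n (by omega))⟩ ⟨i, hi⟩
  refine ⟨t, ht, fun n hn => not_nontrivial_iff_subsingleton.1 fun hn' => ?_⟩
  have := hmax n hn'
  omega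

/-- An object with nonzero cohomology has a bottom cohomology module. -/
theorem exists_bottom (h : IsBoundedFiniteCohomology H) {X : C} {i : ℤ}
    (hi : Nontrivial ((H i).obj X)) :
    ∃ t, Nontrivial ((H t).obj X) ∧ ∀ n, n < t → Subsingleton ((H n).obj X) := by
  obtain ⟨a, b, hab⟩ := h.bounded X
  obtain ⟨t, ht, hmin⟩ := Int.exists_least_of_bdd (P := fun n => Nontrivial ((H n).obj X))
    ⟨a, fun n hn => by
      by_contra hbn
      exact not_subsingleton_iff_nontrivial.2 hn (hab n (by omega))⟩ ⟨i, hi⟩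
  refine ⟨t, ht, fun n hn => not_nontrivial_iff_subsingleton.1 fun hn' => ?_⟩
  have := hmin n hn'
  omega

theorem exists_nontrivial (h : IsBoundedFiniteCohomology H) {X : C} {p : Ideal R}
    [hp : p.IsPrime] (hX : cohomologyAnnihilator H X ≤ p) :
    ∃ n, Nontrivial ((H n).obj X) := by
  obtain ⟨n, hn⟩ := h.exists_annihilator_le hX
  refine ⟨n, not_subsingleton_iff_nontrivial.1 fun hs => hp.ne_top ?_⟩
  rwa [Module.annihilator_eq_top_iff.2 hs, top_le_iff] at hn

variable [(shiftFunctor C (1 : ℤ)).Linear R]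

/-- A Koszul-type construction inside a triangulated subcategory `T`: starting from an object of
`T` supported at the maximal ideal `m` and taking cones of multiplications by finitely many
elements of `m`, one obtains an object of `T` which is still supported at `m`, and on which
these elements act nilpotently. -/
theorem exists_nilpotent_of_finset (h : IsBoundedFiniteCohomology H) (T : ObjectProperty C)
    [T.IsTriangulated] {m : Ideal R} [hm : m.IsMaximal] {X : C} (hXT : T X)
    (hX : cohomologyAnnihilator H X ≤ m) (s : Finset R) (hs : (s : Set R) ⊆ m) :
    ∃ Y : C, T Y ∧ cohomologyAnnihilator H Y ≤ m ∧ ∀ x ∈ s, ∃ N : ℕ, x ^ N • 𝟙 Y = 0 := by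
  classical
  induction s using Finset.induction_on with
  | empty => exact ⟨X, hXT, hX, by simp⟩
  | insert x s _ ih =>
    rw [Finset.coe_insert, Set.insert_subset_iff] at hs
    obtain ⟨Y, hYT, hY, hYs⟩ := ih hs.2
    obtain ⟨Z, hZT, g, p, hZ⟩ := T.distinguished_cocone_triangle (x • 𝟙 Y) hYT hYT
    have hrot := rot_of_distTriang _ hZ
    refine ⟨Z, hZT, ?_, ?_⟩
    · obtain ⟨n, hn⟩ := h.exists_annihilator_le hY
      have := h.finite n Y
      have := h.linear n
      refine (iInf_le _ n).trans
        (annihilator_le_of_exact_smul hs.1 hn ((H n).map g).hom fun y hy => ?_)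
      obtain ⟨z, hz⟩ := (h.exact n _ hZ y).1 hy
      have hxz : (H n).map (x • 𝟙 Y) = x • 𝟙 _ := by
        rw [Functor.map_smul, CategoryTheory.Functor.map_id]
      exact ⟨z, (congrArg (fun f => f.hom z) hxz).symm.trans hz⟩
    -- On the cone of `x`, the element `x` acts with square zero, and an element killing `Y` kills
    -- both maps adjacent to the cone.
    · have key (r : R) (h1 : r • g = 0) (h2 : r • p = 0) : (r * r) • 𝟙 Z = 0 :=
        mul_smul_id_obj₂_eq_zero hrot h1 h2
      intro y hy
      rw [Finset.mem_insert] at hy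
      obtain rfl | hy := hy
      · refine ⟨2, ?_⟩
        rw [pow_two]
        refine key y ?_ ?_
        · have h1 : (y • 𝟙 Y) ≫ g = 0 := comp_distTriang_mor_zero₁₂ _ hZ
          rwa [Linear.smul_comp, Category.id_comp] at h1
        · have h2 : p ≫ (y • 𝟙 Y)⟦(1 : ℤ)⟧' = 0 := comp_distTriang_mor_zero₃₁ _ hZ
          rwa [Functor.map_smul, CategoryTheory.Functor.map_id, Linear.comp_smul,
            Category.comp_id] at h2
      · obtain ⟨N, hN⟩ := hYs y hy
        refine ⟨N + N, ?_⟩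
        rw [pow_add]
        refine key _ ?_ ?_
        · rw [← Category.id_comp g, ← Linear.smul_comp, hN, zero_comp]
        · rw [← Category.comp_id p, ← CategoryTheory.Functor.map_id, ← Linear.comp_smul,
            ← Functor.map_smul, hN, Functor.map_zero, comp_zero]

variable [IsNoetherianRing R] {T₁ T₂ : ObjectProperty C}

/-- The two components of a semi-orthogonal decomposition have disjoint supports. -/
theorem sup_cohomologyAnnihilator_eq_top (h : IsBoundedFiniteCohomology H)
    (hT : IsSemiorthogonalDecomposition T₁ T₂) {A₁ A₂ : C} (h₁ : T₁ A₁) (h₂ : T₂ A₂) :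
    cohomologyAnnihilator H A₁ ⊔ cohomologyAnnihilator H A₂ = ⊤ := by
  by_contra hne
  obtain ⟨m, hm, hle⟩ := Ideal.exists_le_maximal _ hne
  obtain ⟨s, hs⟩ := IsNoetherian.noetherian m
  have hsm : (s : Set R) ⊆ m := hs ▸ Submodule.subset_span
  have := hT.isTriangulated₁
  have := hT.isTriangulated₂
  obtain ⟨B₁, hB₁, hm₁, hn₁⟩ := h.exists_nilpotent_of_finset T₁ h₁ (le_sup_left.trans hle) s hsm
  obtain ⟨B₂, hB₂, hm₂, hn₂⟩ := h.exists_nilpotent_of_finset T₂ h₂ (le_sup_right.trans hle) s hsm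
  obtain ⟨i, hi⟩ := h.exists_nontrivial hm₁
  obtain ⟨j, hj⟩ := h.exists_nontrivial hm₂
  obtain ⟨b, hb, hb'⟩ := h.exists_bottom hi
  obtain ⟨t, ht, ht'⟩ := h.exists_top hj
  have hrad₁ := h.le_radical_annihilator hn₁ b
  have hrad₂ := h.le_radical_annihilator hn₂ t
  rw [Ideal.span, hs] at hrad₁ hrad₂
  have := h.finite t B₂
  obtain ⟨f, hf⟩ := exists_linearMap_ne_zero hrad₂ hrad₁
  obtain ⟨k, g, hg⟩ := h.exists_hom_ne_zero B₂ B₁ t b ht' hb' (ModuleCat.ofHom f)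
    fun hf' => hf (congrArg ModuleCat.Hom.hom hf')
  exact hg (hT.le_rightOrthogonal _ (T₁.le_shift k _ hB₁) g hB₂)

theorem isOrthogonalDecomposition (h : IsBoundedFiniteCohomology H)
    (hT : IsSemiorthogonalDecomposition T₁ T₂) : IsOrthogonalDecomposition T₁ T₂ where
  isTriangulated₁ := hT.isTriangulated₁
  isTriangulated₂ := hT.isTriangulated₂
  le_rightOrthogonal₁ := hT.le_rightOrthogonal
  le_rightOrthogonal₂ A₂ h₂ A₁ f h₁ :=
    h.hom_eq_zero_of_sup_eq_top (h.sup_cohomologyAnnihilator_eq_top hT h₁ h₂) f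
  exists_iso A := by
    obtain ⟨A₂, A₁, f, g, δ, h₂, h₁, hA⟩ := hT.exists_triangle A
    have := hT.isTriangulated₂
    have hδ : δ = 0 := h.hom_eq_zero_of_sup_eq_top
      (h.sup_cohomologyAnnihilator_eq_top hT h₁ (T₂.le_shift 1 _ h₂)) δ
    obtain ⟨e, -⟩ := exists_iso_binaryBiproduct_of_distTriang _ hA hδ
    exact ⟨A₁, A₂, h₁, h₂, ⟨e ≪≫ biprod.braiding _ _⟩⟩

/-- If `Spec R` is connected and some cohomology module of an object `U` is faithful, then the
decomposition of `U` gives an idempotent of `R`. Hence one of the two components of `U` has zero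
cohomology annihilator, and the subcategory not containing this component is zero. -/
theorem isZeroSubcategory_or (h : IsBoundedFiniteCohomology H)
    (hT : IsSemiorthogonalDecomposition T₁ T₂) [PreconnectedSpace (PrimeSpectrum R)]
    {U : C} {n : ℤ} (hU : Module.annihilator R ((H n).obj U) = ⊥) :
    IsZeroSubcategory T₁ ∨ IsZeroSubcategory T₂ := by
  obtain ⟨A₂, A₁, f, g, δ, h₂, h₁, hA⟩ := hT.exists_triangle U
  have hmul (a b : R) (ha : a ∈ cohomologyAnnihilator H A₁)
      (hb : b ∈ cohomologyAnnihilator H A₂) : b * a = 0 := by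
    rw [← Ideal.mem_bot, ← hU, Module.mem_annihilator]
    intro x
    obtain ⟨y, hy⟩ := (h.exact n _ hA (a • x)).1
      ((map_smul _ a x).trans (mem_cohomologyAnnihilator.1 ha n _))
    have hbx : b • (a • x) = 0 := by
      rw [← hy]
      exact (map_smul _ b y).symm.trans
        ((congrArg _ (mem_cohomologyAnnihilator.1 hb n y)).trans (map_zero _))
    rwa [mul_smul]
  have hsup := h.sup_cohomologyAnnihilator_eq_top hT h₁ h₂
  obtain ⟨a, ha, b, hb, hab⟩ := Submodule.mem_sup.1
    (show (1 : R) ∈ cohomologyAnnihilator H A₁ ⊔ cohomologyAnnihilator H A₂ from hsup ▸ trivial)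
  have hidem : IsIdempotentElem a := by
    have h1 := hmul a b ha hb
    change a * a = a
    linear_combination a * hab - h1
  obtain rfl | rfl := hidem.eq_zero_or_eq_one_of_preconnectedSpace
  · right
    rw [zero_add] at hab
    subst hab
    intro B hB
    have hbot : cohomologyAnnihilator H A₁ = ⊥ :=
      eq_bot_iff.2 fun c hc => by simpa using hmul c 1 hc hb
    have := h.sup_cohomologyAnnihilator_eq_top hT h₁ hB
    rw [hbot, bot_sup_eq] at this
    exact h.isZero_of_cohomologyAnnihilator_eq_top this
  · left
    intro B hB
    have hbot : cohomologyAnnihilator H A₂ = ⊥ :=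
      eq_bot_iff.2 fun c hc => by simpa using hmul 1 c ha hc
    have := h.sup_cohomologyAnnihilator_eq_top hT hB h₂
    rw [hbot, sup_bot_eq] at this
    exact h.isZero_of_cohomologyAnnihilator_eq_top this

end IsBoundedFiniteCohomology

end Abstract

/-! ### Cohomology in the derived category of a linear abelian category -/

section SmulId

variable {R : Type*} [Ring R] {C : Type*} [Category C] [Preadditive C] [Linear R C]

theorem smul_id_eq_zero_of_mono {X Y : C} (f : X ⟶ Y) [Mono f] {r : R} (h : r • 𝟙 Y = 0) :
    r • 𝟙 X = 0 := by
  rw [← cancel_mono f, Linear.smul_comp, Category.id_comp, zero_comp, ← Category.comp_id f,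
    ← Linear.comp_smul, h, comp_zero]

theorem smul_id_eq_zero_of_epi {X Y : C} (f : X ⟶ Y) [Epi f] {r : R} (h : r • 𝟙 X = 0) :
    r • 𝟙 Y = 0 := by
  rw [← cancel_epi f, Linear.comp_smul, Category.comp_id, comp_zero, ← Category.id_comp f,
    ← Linear.smul_comp, h, zero_comp]

/-- The shift of a full subcategory of an `R`-linear category with `R`-linear shift is linear. -/
instance fullSubcategory_shiftFunctor_linear [HasShift C ℤ] (P : ObjectProperty C)
    [P.IsStableUnderShift ℤ] (n : ℤ) [(shiftFunctor C n).Linear R] :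
    (shiftFunctor P.FullSubcategory n).Linear R where
  map_smul {X Y} f r := P.ι.map_injective (by
    rw [← cancel_mono ((P.ι.commShiftIso n).hom.app Y), Functor.commShiftIso_hom_naturality,
      Functor.map_smul, Functor.map_smul, Functor.map_smul, Linear.comp_smul, Linear.smul_comp,
      Functor.commShiftIso_hom_naturality])

end SmulId

namespace DerivedCategory

open HomologySequence TStructure

variable {A : Type*} [Category A] [Abelian A] [HasDerivedCategory.{w} A]

theorem homologyFunctor_linear (R : Type*) [Ring R] [Linear R A] (n : ℤ) :
    (homologyFunctor A n).Linear R := by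
  rw [Functor.linear_iff]
  intro X r
  -- It suffices to treat the image of a cochain complex, on which the action is induced by that of
  -- `r` on the complex.
  let e := Q.objObjPreimageIso X
  have hQ : (homologyFunctor A n).map (r • 𝟙 (Q.obj (Q.objPreimage X))) = r • 𝟙 _ := by
    let φ : (homologyFunctor A n).obj (Q.obj (Q.objPreimage X)) ≅ (Q.objPreimage X).homology n :=
      (homologyFunctorFactors A n).app _
    have h1 : HomologicalComplex.homologyMap (r • 𝟙 (Q.objPreimage X)) n = r • 𝟙 _ := by
      rw [← HomologicalComplex.homologyMap_id]
      exact (ShortComplex.homologyMap_smul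
        ((HomologicalComplex.shortComplexFunctor A (ComplexShape.up ℤ) n).map (𝟙 _)) r)
    have h2 : (homologyFunctor A n).map (Q.map (r • 𝟙 (Q.objPreimage X))) ≫ φ.hom =
        φ.hom ≫ HomologicalComplex.homologyMap (r • 𝟙 _) n :=
      homologyFunctorFactors_hom_naturality (r • 𝟙 (Q.objPreimage X)) n
    rw [Functor.map_smul, CategoryTheory.Functor.map_id, h1] at h2
    rw [← cancel_mono φ.hom, h2, Linear.comp_smul, Linear.smul_comp, Category.id_comp,
      Category.comp_id]
  have hi : r • 𝟙 X = e.inv ≫ (r • 𝟙 _) ≫ e.hom := by simp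
  rw [hi, Functor.map_comp, Functor.map_comp, hQ, Linear.smul_comp, Category.id_comp,
    Linear.comp_smul, ← Functor.map_comp, e.inv_hom_id, CategoryTheory.Functor.map_id]

section Truncation

variable (X : DerivedCategory A) (t : ℤ)

theorem mono_homologyMap_truncLTι (n : ℤ) (hn : n ≤ t) :
    Mono ((homologyFunctor A n).map ((TStructure.t.truncLTι t).app X)) := by
  have hT := TStructure.t.triangleLTGE_distinguished t X
  have : IsGE ((TStructure.t.truncGE t).obj X) t := inferInstance
  exact (mono_homologyMap_mor₁_iff _ hT (n - 1) n (by omega)).2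
    ((isZero_of_isGE ((TStructure.t.truncGE t).obj X) t (n - 1) (by omega)).eq_of_src _ _)

theorem epi_homologyMap_truncLTι (n : ℤ) (hn : n < t) :
    Epi ((homologyFunctor A n).map ((TStructure.t.truncLTι t).app X)) := by
  have hT := TStructure.t.triangleLTGE_distinguished t X
  have : IsGE ((TStructure.t.truncGE t).obj X) t := inferInstance
  exact (epi_homologyMap_mor₁_iff _ hT n).2
    ((isZero_of_isGE ((TStructure.t.truncGE t).obj X) t n hn).eq_of_tgt _ _)

theorem epi_homologyMap_truncGEπ (n : ℤ) (hn : t - 1 ≤ n) :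
    Epi ((homologyFunctor A n).map ((TStructure.t.truncGEπ t).app X)) := by
  have hT := TStructure.t.triangleLTGE_distinguished t X
  have : IsLE ((TStructure.t.truncLT t).obj X) (t - 1) := inferInstance
  exact (epi_homologyMap_mor₂_iff _ hT n (n + 1) rfl).2
    ((isZero_of_isLE ((TStructure.t.truncLT t).obj X) (t - 1) (n + 1) (by omega)).eq_of_tgt _ _)

theorem mono_homologyMap_truncGEπ (n : ℤ) (hn : t ≤ n) :
    Mono ((homologyFunctor A n).map ((TStructure.t.truncGEπ t).app X)) := by
  have hT := TStructure.t.triangleLTGE_distinguished t X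
  have : IsLE ((TStructure.t.truncLT t).obj X) (t - 1) := inferInstance
  exact (mono_homologyMap_mor₂_iff _ hT n).2
    ((isZero_of_isLE ((TStructure.t.truncLT t).obj X) (t - 1) n (by omega)).eq_of_src _ _)

end Truncation

/-- A morphism from the top cohomology object of `X` to the bottom cohomology object of `Y`, both
in degree `t`, is induced by a morphism `X ⟶ Y`. -/
theorem exists_homologyMap_eq {X Y : DerivedCategory A} {t : ℤ} [X.IsLE t] [Y.IsGE t]
    (f : (homologyFunctor A t).obj X ⟶ (homologyFunctor A t).obj Y) :
    ∃ g : X ⟶ Y, (homologyFunctor A t).map g = f := by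
  let H := homologyFunctor A t
  -- The truncations of `X` and `Y` to degree `t` are single complexes with the same cohomology in
  -- degree `t`, and `singleFunctor A t` is a section of `H`.
  let p : X ⟶ (TStructure.t.truncGE t).obj X := (TStructure.t.truncGEπ t).app X
  let i : (TStructure.t.truncLT (t + 1)).obj Y ⟶ Y := (TStructure.t.truncLTι (t + 1)).app Y
  have : Epi (H.map p) := epi_homologyMap_truncGEπ X t t (by omega)
  have : Mono (H.map p) := mono_homologyMap_truncGEπ X t t le_rfl
  have : IsIso (H.map p) := isIso_of_mono_of_epi _
  have : Epi (H.map i) := epi_homologyMap_truncLTι Y (t + 1) t (by omega)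
  have : Mono (H.map i) := mono_homologyMap_truncLTι Y (t + 1) t (by omega)
  have : IsIso (H.map i) := isIso_of_mono_of_epi _
  obtain ⟨M, ⟨eM⟩⟩ := exists_iso_singleFunctor_obj_of_isGE_of_isLE
    ((TStructure.t.truncGE t).obj X) t
  obtain ⟨N, ⟨eN⟩⟩ := exists_iso_singleFunctor_obj_of_isGE_of_isLE
    ((TStructure.t.truncLT (t + 1)).obj Y) t
  let φ := singleFunctorCompHomologyFunctorIso A t
  let f' := H.map eM.inv ≫ inv (H.map p) ≫ f ≫ inv (H.map i) ≫ H.map eN.hom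
  let ψ : M ⟶ N := φ.inv.app M ≫ f' ≫ φ.hom.app N
  have hψ : H.map ((singleFunctor A t).map ψ) = f' := by
    have := φ.hom.naturality ψ
    rw [← cancel_mono (φ.hom.app N)]
    refine this.trans ?_
    simp [ψ]
  refine ⟨p ≫ eM.hom ≫ (singleFunctor A t).map ψ ≫ eN.inv ≫ i, ?_⟩
  change H.map _ = _
  simp only [Functor.map_comp, hψ, f']
  simp [← Functor.map_comp_assoc]

theorem exists_hom_shift_ne_zero {X Y : DerivedCategory A} {t b : ℤ} [X.IsLE t] [Y.IsGE b]
    (f : (homologyFunctor A t).obj X ⟶ (homologyFunctor A b).obj Y) (hf : f ≠ 0) :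
    ∃ g : X ⟶ Y⟦b - t⟧, g ≠ 0 := by
  let e : (homologyFunctor A t).obj (Y⟦b - t⟧) ≅ (homologyFunctor A b).obj Y :=
    ((homologyFunctor A 0).shiftIso (b - t) t b (by omega)).app Y
  have : IsGE (Y⟦b - t⟧) t := TStructure.t.isGE_shift Y b (b - t) t (by omega)
  obtain ⟨g, hg⟩ := exists_homologyMap_eq (f ≫ e.inv)
  refine ⟨g, fun h => hf ?_⟩
  rw [h, Functor.map_zero] at hg
  rw [← cancel_mono e.inv, ← hg, zero_comp]

variable {R : Type*} [CommRing R] [Linear R A]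

theorem smul_id_eq_zero_of_isGE_of_isLE {X : DerivedCategory A} {n : ℤ} [X.IsGE n] [X.IsLE n]
    {r : R} (h : r • 𝟙 ((homologyFunctor A n).obj X) = 0) : r • 𝟙 X = 0 := by
  obtain ⟨M, ⟨e⟩⟩ := exists_iso_singleFunctor_obj_of_isGE_of_isLE X n
  let φ : (homologyFunctor A n).obj X ≅ M :=
    (homologyFunctor A n).mapIso e ≪≫ (singleFunctorCompHomologyFunctorIso A n).app M
  have hM := smul_id_eq_zero_of_epi φ.hom h
  refine smul_id_eq_zero_of_mono e.hom ?_
  rw [← CategoryTheory.Functor.map_id, ← Functor.map_smul, hM, Functor.map_zero]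

/-- On a complex whose cohomology lies in an interval of length `k`, a ring element acting by zero
on cohomology has zero `k`-th power: this follows by dévissage along the truncations. -/
theorem pow_smul_id_eq_zero (k : ℕ) {X : DerivedCategory A} {b : ℤ} [X.IsLE b]
    [X.IsGE (b + 1 - k)] {r : R} (h : ∀ n, r • 𝟙 ((homologyFunctor A n).obj X) = 0) :
    r ^ k • 𝟙 X = 0 := by
  induction k generalizing X b with
  | zero =>
    have hX : IsZero X := TStructure.t.isZero X b (b + 1 - ((0 : ℕ) : ℤ)) (by simp)
    exact hX.eq_of_src _ _
  | succ k ih =>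
    let X₁ := (TStructure.t.truncLT b).obj X
    let X₃ := (TStructure.t.truncGE b).obj X
    have : X₁.IsLE (b - 1) := inferInstanceAs (IsLE ((TStructure.t.truncLT b).obj X) (b - 1))
    have : X₃.IsGE b := inferInstanceAs (IsGE ((TStructure.t.truncGE b).obj X) b)
    have : X₃.IsLE b := inferInstanceAs (IsLE ((TStructure.t.truncGE b).obj X) b)
    have : X₁.IsGE (b + 1 - (k + 1 : ℕ)) :=
      inferInstanceAs (IsGE ((TStructure.t.truncLT b).obj X) _)
    have : X₁.IsGE (b - 1 + 1 - k) := by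
      have e : b - 1 + 1 - (k : ℤ) = b + 1 - (k + 1 : ℕ) := by push_cast; ring
      rwa [e]
    have h₁ : r ^ k • 𝟙 X₁ = 0 := ih (b := b - 1) fun n => by
      by_cases hn : n ≤ b
      · have := mono_homologyMap_truncLTι X b n hn
        exact smul_id_eq_zero_of_mono
          ((homologyFunctor A n).map ((TStructure.t.truncLTι b).app X)) (h n)
      · exact (isZero_of_isLE X₁ (b - 1) n (by omega)).eq_of_src _ _
    have h₃ : r • 𝟙 X₃ = 0 := by
      have := epi_homologyMap_truncGEπ X b b (by omega)
      exact smul_id_eq_zero_of_isGE_of_isLE (n := b)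
        (smul_id_eq_zero_of_epi ((homologyFunctor A b).map ((TStructure.t.truncGEπ b).app X)) (h b))
    rw [pow_succ']
    refine mul_smul_id_obj₂_eq_zero (TStructure.t.triangleLTGE_distinguished b X) ?_ ?_
    · change r ^ k • (TStructure.t.truncLTι b).app X = 0
      rw [← Category.id_comp ((TStructure.t.truncLTι b).app X), ← Linear.smul_comp]
      exact (congrArg (· ≫ _) h₁).trans zero_comp
    · change r • (TStructure.t.truncGEπ b).app X = 0
      rw [← Category.comp_id ((TStructure.t.truncGEπ b).app X), ← Linear.comp_smul]
      exact (congrArg (_ ≫ ·) h₃).trans comp_zero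

/-- Let `A` be an abelian category with a fully faithful exact `R`-linear functor `G` to the
category of `R`-modules. On a triangulated category of bounded complexes in `A` whose cohomology
objects correspond to finitely generated modules, the functors `G(Hⁿ(-))` are a bounded finite
cohomology theory. -/
theorem isBoundedFiniteCohomology {R : Type u} [CommRing R] [Linear R A]
    (P : ObjectProperty (DerivedCategory A)) [P.IsTriangulated] (G : A ⥤ ModuleCat.{u} R)
    [G.Full] [G.Faithful] [G.Linear R] [PreservesFiniteLimits G] [PreservesFiniteColimits G]
    (hP : P ≤ (TStructure.t (C := A)).bounded)
    (hG : ∀ X, P X → ∀ n, Module.Finite R (G.obj ((homologyFunctor A n).obj X))) :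
    IsBoundedFiniteCohomology (R := R) (C := P.FullSubcategory)
      (fun n => P.ι ⋙ homologyFunctor A n ⋙ G) where
  linear n := by
    have := homologyFunctor_linear (A := A) R n
    infer_instance
  exact n T hT := by
    have h1 := (homologyFunctor A n).map_distinguished_exact _ (P.ι.map_distinguished T hT)
    have : G.Additive := Functor.additive_of_preserves_binary_products G
    exact (ShortComplex.ShortExact.moduleCat_exact_iff_function_exact _).1 (h1.map G)
  finite n X := hG X.obj X.2 n
  bounded X := by
    obtain ⟨⟨a, ha⟩, ⟨b, hb⟩⟩ := hP _ X.2
    refine ⟨a, b, fun n hn => ModuleCat.subsingleton_of_isZero (G.map_isZero ?_)⟩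
    exact hn.elim (fun h => isZero_of_isGE X.obj a n h) (fun h => isZero_of_isLE X.obj b n h)
  nilpotent X r hr := by
    obtain ⟨⟨a, ha⟩, ⟨b, hb⟩⟩ := hP _ X.2
    have : X.obj.IsGE (b + 1 - (b + 1 - a).toNat) := TStructure.t.isGE_of_ge X.obj _ a (by omega)
    refine ⟨(b + 1 - a).toNat, P.hom_ext (pow_smul_id_eq_zero _ (b := b) fun n => ?_)⟩
    apply G.map_injective
    rw [Functor.map_smul, CategoryTheory.Functor.map_id, Functor.map_zero]
    ext x
    exact Module.mem_annihilator.1 (hr n) x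
  exists_hom_ne_zero X Y t b hX hY f hf := by
    have hzero (Z : P.FullSubcategory) (n : ℤ)
        (h : Subsingleton (G.obj ((homologyFunctor A n).obj Z.obj))) :
        IsZero ((homologyFunctor A n).obj Z.obj) := by
      rw [IsZero.iff_id_eq_zero]
      exact G.map_injective ((ModuleCat.isZero_of_subsingleton _).eq_of_src _ _)
    have : X.obj.IsLE t := (isLE_iff _ _).2 fun n hn => hzero X n (hX n hn)
    have : Y.obj.IsGE b := (isGE_iff _ _).2 fun n hn => hzero Y n (hY n hn)
    obtain ⟨f', rfl⟩ := G.map_surjective f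
    obtain ⟨g, hg⟩ := exists_hom_shift_ne_zero (X := X.obj) (Y := Y.obj) f'
      (fun h => hf (by rw [h, G.map_zero]))
    let g' : X.obj ⟶ (Y⟦b - t⟧).obj := g ≫ (P.ι.commShiftIso (b - t)).inv.app Y
    refine ⟨b - t, P.homMk g', fun h => hg ?_⟩
    have h' : g' = 0 := congrArg (fun f => f.hom) h
    simpa [g'] using h'

theorem annihilator_homology_single {R : Type u} [CommRing R] (G : A ⥤ ModuleCat.{u} R) (M : A) :
    Module.annihilator R (G.obj ((homologyFunctor A 0).obj ((singleFunctor A 0).obj M))) =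
      Module.annihilator R (G.obj M) :=
  (G.mapIso ((singleFunctorCompHomologyFunctorIso A 0).app M)).toLinearEquiv.annihilator_eq

end DerivedCategory

/-! ### Perfect complexes -/

section Perfect

open DerivedCategory

variable {R : Type u} [CommRing R]

theorem CochainComplex.finite_homology [IsNoetherianRing R]
    (K : CochainComplex (ModuleCat.{u} R) ℤ) (n : ℤ) [Module.Finite R (K.X n)] :
    Module.Finite R (K.homology n) := by
  have : Module.Finite R (K.cycles n) :=
    Module.Finite.of_injective (K.iCycles n).hom ((ModuleCat.mono_iff_injective _).1 inferInstance)
  exact Module.Finite.of_surjective (K.homologyπ n).hom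
    ((ModuleCat.epi_iff_surjective _).1 inferInstance)

variable [HasDerivedCategory.{w} (ModuleCat.{u} R)]

theorem isPerfect_le_bounded :
    isPerfect R ≤ (TStructure.t (C := ModuleCat.{u} R)).bounded := by
  rintro X ⟨K, ⟨⟨a, b, hab⟩, -⟩, ⟨e⟩⟩
  have : K.IsStrictlyLE b := (K.isStrictlyLE_iff b).2 fun i hi => hab i (Or.inr hi)
  have : K.IsStrictlyGE a := (K.isStrictlyGE_iff a).2 fun i hi => hab i (Or.inl hi)
  exact ⟨⟨a, TStructure.t.isGE_of_iso e.symm a⟩, ⟨b, TStructure.t.isLE_of_iso e.symm b⟩⟩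

theorem isPerfect.finite_homology [IsNoetherianRing R] {X : DerivedCategory (ModuleCat.{u} R)}
    (hX : isPerfect R X) (n : ℤ) : 
    Module.Finite R ((homologyFunctor (ModuleCat.{u} R) n).obj X) := by
  obtain ⟨K, ⟨-, hK⟩, ⟨e⟩⟩ := hX
  have := (hK n).1
  have := CochainComplex.finite_homology K n
  let i : (homologyFunctor _ n).obj X ≅ K.homology n :=
    (homologyFunctor _ n).mapIso e ≪≫ (homologyFunctorFactors _ n).app K
  exact Module.Finite.equiv i.toLinearEquiv.symm

/-- The module `R`, placed in degree zero, is a perfect complex. -/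
theorem isPerfect_single :
    isPerfect R ((singleFunctor (ModuleCat.{u} R) 0).obj (ModuleCat.of R R)) := by
  have hzero (n : ℤ) (hn : n ≠ 0) : IsZero (((CochainComplex.singleFunctor (ModuleCat.{u} R) 0).obj
      (ModuleCat.of R R)).X n) := HomologicalComplex.isZero_single_obj_X _ _ _ _ hn
  refine ⟨(CochainComplex.singleFunctor _ 0).obj (ModuleCat.of R R),
    ⟨⟨0, 0, fun n hn => hzero n (by omega)⟩, fun n => ?_⟩,
    ⟨(singleFunctorIsoCompQ _ 0).app _⟩⟩
  by_cases hn : n = 0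
  · subst hn
    let e : R ≃ₗ[R] ((CochainComplex.singleFunctor (ModuleCat.{u} R) 0).obj
        (ModuleCat.of R R)).X 0 :=
      (HomologicalComplex.singleObjXSelf (ComplexShape.up ℤ) 0
        (ModuleCat.of R R)).symm.toLinearEquiv
    exact ⟨Module.Finite.equiv e, Module.Projective.of_equiv e⟩
  · have := ModuleCat.subsingleton_of_isZero (hzero n hn)
    exact ⟨inferInstance, inferInstance⟩

/-- A semi-orthogonal decomposition of `Perf(R)` is orthogonal, and trivial if `Spec R` is
connected. -/
theorem isOrthogonalDecomposition_perf [IsNoetherianRing R] (T₁ T₂ : ObjectProperty (Perf R))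
    (hT : IsSemiorthogonalDecomposition T₁ T₂) :
    IsOrthogonalDecomposition T₁ T₂ ∧
      (PreconnectedSpace (PrimeSpectrum R) → IsZeroSubcategory T₁ ∨ IsZeroSubcategory T₂) := by
  have h := isBoundedFiniteCohomology (isPerfect R) (𝟭 (ModuleCat.{u} R)) isPerfect_le_bounded
    fun X hX n => hX.finite_homology n
  refine ⟨h.isOrthogonalDecomposition hT, fun hX => ?_⟩
  exact h.isZeroSubcategory_or hT (U := ⟨_, isPerfect_single⟩) (n := 0)
    ((annihilator_homology_single (𝟭 (ModuleCat.{u} R)) _).trans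
      (Module.annihilator_eq_bot.2 (inferInstanceAs (FaithfulSMul R R))))

end Perfect

/-! ### Coherent sheaves -/

section Coherent

/-- Transport of an `R`-linear structure along a fully faithful additive functor. -/
abbrev linearOfFullyFaithful {R : Type*} [Ring R] {A B : Type*} [Category A] [Category B]
    [Preadditive A] [Preadditive B] [Linear R B] (G : A ⥤ B) [G.Additive] (hG : G.FullyFaithful) :
    Linear R A where
  homModule X Y :=
    letI : SMul R (X ⟶ Y) := ⟨fun r f => hG.preimage (r • G.map f)⟩
    Function.Injective.module R G.mapAddHom (fun _ _ h => hG.map_injective h)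
      fun r f => hG.map_preimage (r • G.map f)
  smul_comp X Y Z r f g := hG.map_injective (by
    change G.map (hG.preimage (r • G.map f) ≫ g) = G.map (hG.preimage _)
    simp)
  comp_smul X Y Z f r g := hG.map_injective (by
    change G.map (f ≫ hG.preimage (r • G.map g)) = G.map (hG.preimage _)
    simp)

variable (R : CommRingCat.{u}) [IsNoetherianRing R]

/-- The global sections functor from coherent sheaves on `Spec R` to `R`-modules, defined as the
inverse of `M ↦ M^~`. -/
noncomputable abbrev cohΓ : Coh (Spec R) ⥤ ModuleCat.{u} R :=
  (cohTilde R).inv ⋙ (ModuleCat.isFG R).ι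

instance : PreservesFiniteLimits (ModuleCat.isFG.{u} R).ι :=
  inferInstanceAs (PreservesFiniteLimits (forget₂ (FGModuleCat R) (ModuleCat.{u} R)))

instance : PreservesFiniteColimits (ModuleCat.isFG.{u} R).ι :=
  inferInstanceAs (PreservesFiniteColimits (forget₂ (FGModuleCat R) (ModuleCat.{u} R)))

instance : (cohΓ R).Additive := Functor.additive_of_preserves_binary_products _

/-- The `R`-linear structure on coherent sheaves on `Spec R`, transported from `R`-modules along
the global sections functor. -/
noncomputable instance : Linear R (Coh (Spec R)) :=
  linearOfFullyFaithful (cohΓ R) (.ofFullyFaithful _)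

instance : (cohΓ R).Linear R where
  map_smul f r := (Functor.FullyFaithful.ofFullyFaithful (cohΓ R)).map_preimage (r • (cohΓ R).map f)

/-- The structure sheaf is coherent, with faithful module of global sections. -/
theorem annihilator_cohΓ_tilde : Module.annihilator R ((cohΓ R).obj ((cohTilde R).obj
    (FGModuleCat.of R R))) = ⊥ := by
  let e : (cohΓ R).obj ((cohTilde R).obj (FGModuleCat.of R R)) ≅
    ModuleCat.of R R := (ModuleCat.isFG R).ι.mapIso
      ((cohTilde R).asEquivalence.unitIso.symm.app (FGModuleCat.of R R))
  rw [e.toLinearEquiv.annihilator_eq]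
  exact Module.annihilator_eq_bot.2 inferInstance

open DerivedCategory in
/-- A semi-orthogonal decomposition of `D^b(coh (Spec R))` is orthogonal, and trivial if `Spec R` is
connected. -/
theorem isOrthogonalDecomposition_bounded_coh [HasDerivedCategory.{w} (Coh (Spec R))]
    (T₁ T₂ : ObjectProperty (DerivedCategory.Bounded (Coh (Spec R))))
    (hT : IsSemiorthogonalDecomposition T₁ T₂) :
    IsOrthogonalDecomposition T₁ T₂ ∧
      (PreconnectedSpace (Spec R) → IsZeroSubcategory T₁ ∨ IsZeroSubcategory T₂) := by
  have h := isBoundedFiniteCohomology (R := R)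
    (TStructure.t (C := Coh (Spec R))).bounded (cohΓ R) le_rfl
    fun X _ n => ((cohTilde R).inv.obj ((homologyFunctor _ n).obj X)).2
  refine ⟨h.isOrthogonalDecomposition hT, fun hX => ?_⟩
  have : PreconnectedSpace (PrimeSpectrum R) := hX
  let U : DerivedCategory.Bounded (Coh (Spec R)) := ⟨(singleFunctor _ 0).obj
    ((cohTilde R).obj (FGModuleCat.of R R)), ⟨0, inferInstance⟩, ⟨0, inferInstance⟩⟩
  exact h.isZeroSubcategory_or hT (U := U) (n := 0)
    ((annihilator_homology_single (cohΓ R) _).trans (annihilator_cohΓ_tilde R))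

end Coherent

theorem corollary2p3 (R : Type u) [CommRing R] [IsNoetherianRing R]
    [HasDerivedCategory.{w} (Coh (Spec (CommRingCat.of R)))]
    [HasDerivedCategory.{w'} (ModuleCat.{u} R)] :
    (∀ T₁ T₂ : ObjectProperty (DbCohSpec R), IsSemiorthogonalDecomposition T₁ T₂ →
      IsOrthogonalDecomposition T₁ T₂ ∧
        (PreconnectedSpace (Spec (CommRingCat.of R)) →
          IsZeroSubcategory T₁ ∨ IsZeroSubcategory T₂)) ∧
    (∀ T₁ T₂ : ObjectProperty (Perf R), IsSemiorthogonalDecomposition T₁ T₂ →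
      IsOrthogonalDecomposition T₁ T₂ ∧
        (PreconnectedSpace (Spec (CommRingCat.of R)) →
          IsZeroSubcategory T₁ ∨ IsZeroSubcategory T₂)) := by
  exact ⟨isOrthogonalDecomposition_bounded_coh (CommRingCat.of R), isOrthogonalDecomposition_perf⟩
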